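/- Let $k$ be a commutative ring and $X$ a finite set, with symmetric group $\Sigma$. Relations on $X$ are subsets of $X\times X$, composed by $RS=\{(x,z)\mid \exists y,\ (x,y)\in R,\ (y,z)\in S\}$; for $\sigma\in\Sigma$ put $\Delta_\sigma=\{(\sigma(x),x)\mid x\in X\}$, so that $\Delta_\sigma\Delta_\tau=\Delta_{\sigma\tau}$. A relation $R$ is inessential if $R=ST$ with $S\subseteq X\times Y$, $T\subseteq Y\times X$ for some finite set $Y$ with $|Y|<|X|$, and essential otherwise. Let $\mathcal R$ be the $k$-algebra of the monoid of all relations on $X$, let $I$ be the two-sided ideal of $\mathcal R$ spanned over $k$ by the inessential relations, and $\mathcal E=\mathcal R/I$. Let $N$ be the $k$-submodule (in fact a two-sided ideal) of $\mathcal E$ spanned by all $(S-\overline S)\Delta_\sigma$, where $S$ is a reflexive essential relation, $\overline S$ its transitive closure, and $\sigma\in\Sigma$. Put $\mathcal P=\mathcal E/N$, the algebra of permuted orders. Let $\mathcal O$ be the set of all (partial) orders on $X$, partially ordered by containment, with Möbius function $\mu$, and let $\Sigma$ act on $\mathcal O$ by ${}^\sigma R=\Delta_\sigma R\Delta_{\sigma^{-1}}$.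 For $R\in\mathcal O$ let $\Sigma_R$ be its stabilizer, and define in $\mathcal P$ $$f_R=\sum_{S\in\mathcal O,\ R\subseteq S}\mu(R,S)\,S,\qquad e_R=\sum_{\sigma\in[\Sigma/\Sigma_R]}\Delta_\sigma f_R\Delta_{\sigma^{-1}},$$ where $[\Sigma/\Sigma_R]$ is a set of representatives of the cosets $\sigma\Sigma_R$. **Theorem.** For every order $R$ on $X$, the element $e_R$ is a central idempotent of $\mathcal P$, and there is an isomorphism of (unital) $k$-algebras $$\mathcal P e_R\cong M_{|\Sigma:\Sigma_R|}(k\Sigma_R),$$ where $\mathcal P e_R$ has identity element $e_R$. Moreover, for every set $[\Sigma\backslash\mathcal O]$ of representatives of the $\Sigma$-orbits on $\mathcal O$, there is an isomorphism of $k$-algebras $$\mathcal P\cong\prod_{R\in[\Sigma\backslash\mathcal O]}M_{|\Sigma:\Sigma_R|}(k\Sigma_R).$$ -/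

import Mathlib

namespace PermutedOrders

universe u v

/-- A relation on `X`, i.e. a subset of `X × X`; `R a b` means `(a, b) ∈ R`. -/
def BinRel (X : Type u) : Type u := X → X → Prop

namespace BinRel

variable {X : Type u}

@[ext] theorem ext {R S : BinRel X} (h : ∀ a b, R a b ↔ S a b) : R = S :=
  funext fun a => funext fun b => propext (h a b)

/-- Containment of relations. -/
instance : PartialOrder (BinRel X) := inferInstanceAs (PartialOrder (X → X → Prop))

theorem le_def {R S : BinRel X} : R ≤ S ↔ ∀ a b, R a b → S a b := Iff.rfl

/-- The monoid of all relations on `X`: the product is the composition of relations, and the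
identity is the equality relation. -/
instance : Monoid (BinRel X) where
  mul R S := Relation.Comp R S
  one := fun a b => a = b
  mul_assoc R S T := Relation.comp_assoc
  one_mul R := Relation.eq_comp
  mul_one R := Relation.comp_eq

theorem mul_apply {R S : BinRel X} {a c : X} : (R * S) a c ↔ ∃ b, R a b ∧ S b c := Iff.rfl

theorem one_apply {a b : X} : (1 : BinRel X) a b ↔ a = b := Iff.rfl

/-- The relation `Δ_σ = {(σ x, x) | x ∈ X}`, as a homomorphism from the symmetric group. -/
def perm : Equiv.Perm X →* BinRel X where
  toFun σ := fun a b => a = σ b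
  map_one' := rfl
  map_mul' σ τ := by
    ext a b
    change a = σ (τ b) ↔ ∃ c, a = σ c ∧ c = τ b
    constructor
    · intro h
      exact ⟨τ b, h, rfl⟩
    · rintro ⟨c, h, h2⟩
      rw [h, h2]

theorem perm_apply {σ : Equiv.Perm X} {a b : X} : perm σ a b ↔ a = σ b := Iff.rfl

theorem perm_mul_apply {σ : Equiv.Perm X} {R : BinRel X} {a b : X} :
    (perm σ * R) a b ↔ R (σ⁻¹ a) b := by
  rw [mul_apply]
  constructor
  · rintro ⟨c, h, h2⟩
    rw [perm_apply] at h
    rw [h]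
    simpa using h2
  · intro h
    exact ⟨σ⁻¹ a, by simp [perm_apply], h⟩

theorem mul_perm_apply {σ : Equiv.Perm X} {R : BinRel X} {a b : X} :
    (R * perm σ) a b ↔ R a (σ b) := by
  rw [mul_apply]
  constructor
  · rintro ⟨c, h, h2⟩
    rw [perm_apply] at h2
    rwa [← h2]
  · intro h
    exact ⟨σ b, h, rfl⟩

/-- `R` is inessential if it factorizes through a set `Y` with `Card Y < Card X`. -/
def Inessential [Fintype X] (R : BinRel X) : Prop :=
  ∃ (Y : Type u) (_ : Fintype Y) (S : X → Y → Prop) (T : Y → X → Prop),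
    Fintype.card Y < Fintype.card X ∧ R = Relation.Comp S T

/-- `R` is essential if it is not inessential. -/
def Essential [Fintype X] (R : BinRel X) : Prop := ¬ R.Inessential

/-- `R` contains the diagonal. -/
def IsRefl (R : BinRel X) : Prop := ∀ a, R a a

/-- The transitive closure of `R`. -/
def tc (R : BinRel X) : BinRel X := Relation.TransGen R

/-- `R` is a (partial) order: reflexive, transitive and antisymmetric. -/
def IsOrder (R : BinRel X) : Prop := IsPartialOrder X R

theorem Inessential.mul_left [Fintype X] {R : BinRel X} (h : R.Inessential) (T : BinRel X) :
    (T * R).Inessential := by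
  obtain ⟨Y, i, A, B, hc, rfl⟩ := h
  exact ⟨Y, i, Relation.Comp T A, B, hc, Relation.comp_assoc.symm⟩

theorem Inessential.mul_right [Fintype X] {R : BinRel X} (h : R.Inessential) (T : BinRel X) :
    (R * T).Inessential := by
  obtain ⟨Y, i, A, B, hc, rfl⟩ := h
  exact ⟨Y, i, A, Relation.Comp B T, hc, Relation.comp_assoc⟩

theorem tc_refl {R : BinRel X} (h : R.IsRefl) : R.tc.IsRefl :=
  fun a => Relation.TransGen.single (h a)

theorem le_tc (R : BinRel X) : R ≤ R.tc := fun _ _ h => Relation.TransGen.single h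

/-- A reflexive transitive relation which is not an order is inessential. -/
theorem inessential_of_not_isOrder [Fintype X] {R : BinRel X} (h1 : R.IsRefl)
    (h2 : ∀ a b c, R a b → R b c → R a c) (h3 : ¬ R.IsOrder) : R.Inessential := by
  classical
  have h4 : ∃ a b, R a b ∧ R b a ∧ a ≠ b := by
    by_contra! h
    exact h3 { refl := h1, trans := h2, antisymm := h }
  obtain ⟨a, b, hab, hba, hne⟩ := h4
  refine ⟨{y : X // y ≠ b}, inferInstance, fun x y => R x y, fun y z => R y z, ?_, ?_⟩
  · exact Fintype.card_subtype_lt (x := b) (by simp)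
  · ext x z
    constructor
    · intro h
      by_cases hx : x = b
      · subst hx
        exact ⟨⟨a, hne⟩, hba, h2 _ _ _ hab h⟩
      · exact ⟨⟨x, hx⟩, h1 x, h⟩
    · rintro ⟨y, h, h'⟩
      exact h2 _ _ _ h h'

/-- A reflexive relation contained in an order is essential. -/
theorem essential_of_le_isOrder [Fintype X] {Q R : BinRel X} (hQ : Q.IsRefl) (hR : R.IsOrder)
    (hle : Q ≤ R) : Q.Essential := by
  rintro ⟨Y, i, S, T, hc, rfl⟩
  choose f hf using hQ
  obtain ⟨a, b, hne, hab⟩ := Fintype.exists_ne_map_eq_of_card_lt f hc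
  apply hne
  have h1 : R a b := hle _ _ ⟨f a, (hf a).1, hab ▸ (hf b).2⟩
  have h2 : R b a := hle _ _ ⟨f a, hab ▸ (hf b).1, (hf a).2⟩
  exact hR.antisymm _ _ h1 h2

/-- Every essential relation contains a permutation. -/
theorem Essential.exists_perm_le [Fintype X] {R : BinRel X} (h : R.Essential) :
    ∃ σ : Equiv.Perm X, perm σ ≤ R := by
  classical
  have key := (Finset.all_card_le_biUnion_card_iff_exists_injective
    (fun y : X => Finset.univ.filter fun x => R x y)).1 ?_
  · obtain ⟨f, hf, hfR⟩ := key
    refine ⟨Equiv.ofBijective f (Finite.injective_iff_bijective.1 hf), ?_⟩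
    intro a b hab
    have := hfR b
    rw [perm_apply] at hab
    rw [hab]
    simpa using this
  · intro A
    by_contra! hlt
    apply h
    set B := A.biUnion (fun y : X => Finset.univ.filter fun x => R x y) with hB
    refine ⟨{y : X // y ∈ Aᶜ} ⊕ {x : X // x ∈ B}, inferInstance,
      fun x y => Sum.elim (fun y => R x y.1) (fun w => x = w.1) y,
      fun y z => Sum.elim (fun y => y.1 = z) (fun w => R w.1 z) y, ?_, ?_⟩
    · rw [Fintype.card_sum, Fintype.card_coe, Fintype.card_coe, Finset.card_compl]
      have := Finset.card_le_univ A
      omega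
    · ext x z
      constructor
      · intro hxz
        by_cases hz : z ∈ A
        · refine ⟨Sum.inr ⟨x, ?_⟩, rfl, hxz⟩
          rw [hB, Finset.mem_biUnion]
          exact ⟨z, hz, by simpa using hxz⟩
        · exact ⟨Sum.inl ⟨z, by simpa using hz⟩, hxz, rfl⟩
      · rintro ⟨y | w, h1, h2⟩
        · have h2' : y.1 = z := h2
          rw [← h2']
          exact h1
        · have h1' : x = w.1 := h1
          rw [h1']
          exact h2

theorem inessential_tc [Fintype X] {Q : BinRel X} (hQ : Q.IsRefl) (h : Q.Inessential) :
    Q.tc.Inessential := by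
  apply inessential_of_not_isOrder (tc_refl hQ) fun _ _ _ => Relation.TransGen.trans
  intro ho
  exact essential_of_le_isOrder hQ ho (le_tc Q) h

end BinRel

/-! ### The essential algebra -/

section Algebra

variable (k : Type v) [CommRing k] (X : Type u) [Fintype X]

/-- The `k`-algebra of the monoid of all relations on `X`. -/
abbrev RelAlg : Type (max u v) := MonoidAlgebra k (BinRel X)

/-- The ideal `I` of the algebra of all relations: the `k`-linear span of the inessential
relations. -/
noncomputable def inessentialIdeal : Ideal (RelAlg k X) where
  __ := (Submodule.span k (MonoidAlgebra.of k (BinRel X) '' {R | R.Inessential})).toAddSubmonoid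
  smul_mem' c x hx := by
    change c * x ∈ Submodule.span k _
    change x ∈ Submodule.span k _ at hx
    induction hx using Submodule.span_induction with
    | zero => simp
    | add x y _ _ hx hy => rw [mul_add]; exact add_mem hx hy
    | smul a x _ hx => rw [mul_smul_comm]; exact Submodule.smul_mem _ _ hx
    | mem x hx =>
      obtain ⟨R, hR, rfl⟩ := hx
      induction c using MonoidAlgebra.induction_on with
      | of T =>
        rw [← map_mul]
        exact Submodule.subset_span ⟨T * R, BinRel.Inessential.mul_left hR T, rfl⟩
      | add a b ha hb => rw [add_mul]; exact add_mem ha hb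
      | smul r a ha => rw [smul_mul_assoc]; exact Submodule.smul_mem _ _ ha

theorem mem_inessentialIdeal {x : RelAlg k X} : x ∈ inessentialIdeal k X ↔
    x ∈ Submodule.span k (MonoidAlgebra.of k (BinRel X) '' {R | R.Inessential}) := Iff.rfl

instance : (inessentialIdeal k X).IsTwoSided where
  mul_mem_of_left {x} c hx := by
    rw [mem_inessentialIdeal] at hx ⊢
    induction hx using Submodule.span_induction with
    | zero => simp
    | add x y _ _ hx hy => rw [add_mul]; exact add_mem hx hy
    | smul a x _ hx => rw [smul_mul_assoc]; exact Submodule.smul_mem _ _ hx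
    | mem x hx =>
      obtain ⟨R, hR, rfl⟩ := hx
      induction c using MonoidAlgebra.induction_on with
      | of T =>
        rw [← map_mul]
        exact Submodule.subset_span ⟨R * T, BinRel.Inessential.mul_right hR T, rfl⟩
      | add a b ha hb => rw [mul_add]; exact add_mem ha hb
      | smul r a ha => rw [mul_smul_comm]; exact Submodule.smul_mem _ _ ha

/-- The essential algebra `E`. -/
abbrev EssAlg : Type (max u v) := RelAlg k X ⧸ inessentialIdeal k X

variable {X}

/-- The image of a relation in the essential algebra. -/
noncomputable def toEss : BinRel X →* EssAlg k X :=
  (Ideal.Quotient.mk (inessentialIdeal k X) : RelAlg k X →* EssAlg k X).comp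
    (MonoidAlgebra.of k (BinRel X))

theorem toEss_eq_zero {R : BinRel X} (h : R.Inessential) : toEss k R = 0 :=
  Ideal.Quotient.eq_zero_iff_mem.2 (Submodule.subset_span ⟨R, h, rfl⟩)

theorem essAlg_induction {p : EssAlg k X → Prop} (x : EssAlg k X)
    (hrel : ∀ R : BinRel X, p (toEss k R)) (hadd : ∀ a b, p a → p b → p (a + b))
    (hsmul : ∀ (r : k) a, p a → p (r • a)) : p x := by
  obtain ⟨y, rfl⟩ := Ideal.Quotient.mk_surjective x
  induction y using MonoidAlgebra.induction_on with
  | of T => exact hrel T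
  | add a b ha hb => rw [map_add]; exact hadd _ _ ha hb
  | smul r a ha => exact hsmul r _ ha

variable (X)

/-- The `k`-submodule of `E` spanned by the elements `(S - tc S) Δ_σ`, where `S` is a reflexive
essential relation and `σ` a permutation. -/
noncomputable def nilSpan : Submodule k (EssAlg k X) :=
  Submodule.span k {x | ∃ (S : BinRel X) (σ : Equiv.Perm X), S.Essential ∧ S.IsRefl ∧
    x = (toEss k S - toEss k S.tc) * toEss k (BinRel.perm σ)}

variable {X}

theorem sub_tc_mem {Q : BinRel X} (hQ : Q.IsRefl) (σ : Equiv.Perm X) :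
    (toEss k Q - toEss k Q.tc) * toEss k (BinRel.perm σ) ∈ nilSpan k X := by
  by_cases h : Q.Inessential
  · rw [toEss_eq_zero k h, toEss_eq_zero k (BinRel.inessential_tc hQ h)]
    simp
  · exact Submodule.subset_span ⟨Q, σ, h, hQ, rfl⟩

theorem sub_mem_of_tc_eq {Q Q' : BinRel X} (hQ : Q.IsRefl) (hQ' : Q'.IsRefl)
    (h : Q' ≤ Q.tc) (h' : Q ≤ Q'.tc) (σ : Equiv.Perm X) :
    (toEss k Q - toEss k Q') * toEss k (BinRel.perm σ) ∈ nilSpan k X := by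
  have e : Q.tc = Q'.tc := by
    ext a b
    exact ⟨fun hab => Relation.TransGen.closed h' _ _ hab, fun hab => Relation.TransGen.closed h _ _ hab⟩
  have := sub_mem (sub_tc_mem k hQ σ) (sub_tc_mem k hQ' σ)
  rw [e, ← sub_mul] at this
  simpa using this

theorem toEss_mul_mem {S : BinRel X} (hS : S.IsRefl) (σ : Equiv.Perm X) (T : BinRel X) :
    toEss k T * ((toEss k S - toEss k S.tc) * toEss k (BinRel.perm σ)) ∈ nilSpan k X := by
  by_cases hT : T.Inessential
  · rw [toEss_eq_zero k hT, zero_mul]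
    exact zero_mem _
  obtain ⟨τ, hτ⟩ := BinRel.Essential.exists_perm_le hT
  have hτ' : ∀ b, T (τ b) b := fun b => hτ _ _ rfl
  have key := sub_mem_of_tc_eq k (Q := T * S * BinRel.perm τ⁻¹) (Q' := T * S.tc * BinRel.perm τ⁻¹)
    ?_ ?_ ?_ ?_ (τ * σ)
  · have e : ∀ R : BinRel X, toEss k (T * R * BinRel.perm τ⁻¹) * toEss k (BinRel.perm (τ * σ)) =
        toEss k T * (toEss k R * toEss k (BinRel.perm σ)) := by
      intro R
      simp only [← map_mul, mul_assoc]
      simp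
    rw [sub_mul, e, e] at key
    rwa [sub_mul, mul_sub]
  · intro a
    rw [BinRel.mul_perm_apply]
    exact ⟨τ⁻¹ a, by simpa using hτ' (τ⁻¹ a), hS _⟩
  · intro a
    rw [BinRel.mul_perm_apply]
    exact ⟨τ⁻¹ a, by simpa using hτ' (τ⁻¹ a), BinRel.tc_refl hS _⟩
  · intro x z hxz
    rw [BinRel.mul_perm_apply] at hxz
    obtain ⟨y, hxy, hyz⟩ := hxz
    have claim : ∀ w, Relation.TransGen S y w →
        (T * S * BinRel.perm τ⁻¹).tc x (τ w) := by
      intro w hw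
      induction hw with
      | single h =>
        refine Relation.TransGen.single ?_
        rw [BinRel.mul_perm_apply]
        exact ⟨y, hxy, by simpa using h⟩
      | @tail b c _ hbc ih =>
        refine Relation.TransGen.tail ih ?_
        rw [BinRel.mul_perm_apply]
        exact ⟨b, hτ' b, by simpa using hbc⟩
    simpa using claim _ hyz
  · intro x z hxz
    refine Relation.TransGen.single ?_
    rw [BinRel.mul_perm_apply] at hxz ⊢
    obtain ⟨y, hxy, hyz⟩ := hxz
    exact ⟨y, hxy, Relation.TransGen.single hyz⟩

theorem mul_toEss_mem {S : BinRel X} (hS : S.IsRefl) (σ : Equiv.Perm X) (T : BinRel X) :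
    ((toEss k S - toEss k S.tc) * toEss k (BinRel.perm σ)) * toEss k T ∈ nilSpan k X := by
  by_cases hT : T.Inessential
  · rw [toEss_eq_zero k hT, mul_zero]
    exact zero_mem _
  obtain ⟨τ, hτ⟩ := BinRel.Essential.exists_perm_le hT
  have hτ' : ∀ b, T (τ b) b := fun b => hτ _ _ rfl
  set U : BinRel X := BinRel.perm σ * T * BinRel.perm (σ * τ)⁻¹ with hU
  have hUr : U.IsRefl := by
    intro a
    rw [hU, BinRel.mul_perm_apply, BinRel.perm_mul_apply]
    have := hτ' ((σ * τ)⁻¹ a)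
    simpa using this
  have key := sub_mem_of_tc_eq k (Q := S * U) (Q' := S.tc * U) ?_ ?_ ?_ ?_ (σ * τ)
  · have e : ∀ R : BinRel X, toEss k (R * U) * toEss k (BinRel.perm (σ * τ)) =
        toEss k R * (toEss k (BinRel.perm σ) * toEss k T) := by
      intro R
      rw [hU]
      simp only [← map_mul, mul_assoc]
      simp
    rw [sub_mul, e, e] at key
    rwa [mul_assoc, sub_mul]
  · exact fun a => ⟨a, hS a, hUr a⟩
  · exact fun a => ⟨a, BinRel.tc_refl hS a, hUr a⟩
  · rintro x z ⟨y, hxy, hyz⟩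
    have h1 : (S * U).tc x y :=
      Relation.TransGen.mono (p := S * U) (fun a b h => ⟨b, h, hUr b⟩) _ _ hxy
    exact Relation.TransGen.tail h1 ⟨y, hS y, hyz⟩
  · rintro x z ⟨y, hxy, hyz⟩
    exact Relation.TransGen.single ⟨y, Relation.TransGen.single hxy, hyz⟩

variable (X)

/-- The ideal `N` of the essential algebra: the `k`-submodule spanned by the elements
`(S - tc S) Δ_σ`, where `S` is a reflexive essential relation and `σ` a permutation. -/
noncomputable def nilIdeal : Ideal (EssAlg k X) where
  __ := (nilSpan k X).toAddSubmonoid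
  smul_mem' c x hx := by
    change c * x ∈ nilSpan k X
    change x ∈ nilSpan k X at hx
    induction hx using Submodule.span_induction with
    | zero => simp
    | add x y _ _ hx hy => rw [mul_add]; exact add_mem hx hy
    | smul a x _ hx => rw [mul_smul_comm]; exact Submodule.smul_mem _ _ hx
    | mem x hx =>
      obtain ⟨S, σ, -, hS, rfl⟩ := hx
      induction c using essAlg_induction with
      | hrel T => exact toEss_mul_mem k hS σ T
      | hadd a b ha hb => rw [add_mul]; exact add_mem ha hb
      | hsmul r a ha => rw [smul_mul_assoc]; exact Submodule.smul_mem _ _ ha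

theorem mem_nilIdeal {x : EssAlg k X} : x ∈ nilIdeal k X ↔ x ∈ nilSpan k X := Iff.rfl

instance : (nilIdeal k X).IsTwoSided where
  mul_mem_of_left {x} c hx := by
    rw [mem_nilIdeal] at hx ⊢
    induction hx using Submodule.span_induction with
    | zero => simp
    | add x y _ _ hx hy => rw [add_mul]; exact add_mem hx hy
    | smul a x _ hx => rw [smul_mul_assoc]; exact Submodule.smul_mem _ _ hx
    | mem x hx =>
      obtain ⟨S, σ, -, hS, rfl⟩ := hx
      induction c using essAlg_induction with
      | hrel T => exact mul_toEss_mem k hS σ T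
      | hadd a b ha hb => rw [mul_add]; exact add_mem ha hb
      | hsmul r a ha => rw [mul_smul_comm]; exact Submodule.smul_mem _ _ ha

/-- The algebra `P = E / N` of permuted orders on `X`. -/
abbrev PermAlg : Type (max u v) := EssAlg k X ⧸ nilIdeal k X

variable {X}

/-- The image of a relation in the algebra of permuted orders. -/
noncomputable def toPerm : BinRel X →* PermAlg k X :=
  (Ideal.Quotient.mk (nilIdeal k X) : EssAlg k X →* PermAlg k X).comp (toEss k)

end Algebra

/-! ### Orders, the idempotents `f_R` and `e_R` -/

/-- The set of all orders on `X`. -/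
abbrev OrderOn (X : Type u) : Type u := {R : BinRel X // R.IsOrder}

section Orders

variable {X : Type u}

/-- The symmetric group acts on orders by conjugation, `σ • R = Δ_σ R Δ_{σ⁻¹}`. -/
instance : MulAction (Equiv.Perm X) (OrderOn X) where
  smul σ R := ⟨BinRel.perm σ * R.1 * BinRel.perm σ⁻¹, by
    have h : ∀ a b, (BinRel.perm σ * R.1 * BinRel.perm σ⁻¹) a b ↔ R.1 (σ⁻¹ a) (σ⁻¹ b) := by
      intro a b
      rw [BinRel.mul_perm_apply, BinRel.perm_mul_apply]
    have hR : IsPartialOrder X R.1 := R.2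
    exact
      { refl := fun a => (h a a).2 (hR.refl _)
        trans := fun a b c hab hbc =>
          (h a c).2 (hR.trans _ _ _ ((h a b).1 hab) ((h b c).1 hbc))
        antisymm := fun a b hab hba =>
          σ⁻¹.injective (hR.antisymm _ _ ((h a b).1 hab) ((h b a).1 hba)) }⟩
  one_smul R := Subtype.ext (by
    change BinRel.perm 1 * R.1 * BinRel.perm 1⁻¹ = R.1
    simp)
  mul_smul σ τ R := Subtype.ext (by
    change BinRel.perm (σ * τ) * R.1 * BinRel.perm (σ * τ)⁻¹ =
      BinRel.perm σ * (BinRel.perm τ * R.1 * BinRel.perm τ⁻¹) * BinRel.perm σ⁻¹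
    simp [mul_assoc])

theorem coe_smul (σ : Equiv.Perm X) (R : OrderOn X) :
    ((σ • R : OrderOn X) : BinRel X) = BinRel.perm σ * R.1 * BinRel.perm σ⁻¹ := rfl

variable [Fintype X]

noncomputable instance : Fintype (OrderOn X) := by
  classical
  have : Finite (BinRel X) := inferInstanceAs (Finite (X → X → Prop))
  exact Fintype.ofFinite _

noncomputable instance : LocallyFiniteOrder (OrderOn X) := by
  classical
  exact Fintype.toLocallyFiniteOrder

variable (k : Type v) [CommRing k]

open Classical in
/-- `f_R = ∑ μ(R, S) S`, the sum over the orders `S` containing `R`, where `μ` is the Möbius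
function of the poset of all orders on `X` (ordered by containment). -/
noncomputable def f (R : OrderOn X) : PermAlg k X :=
  ∑ S ∈ Finset.univ.filter (fun S : OrderOn X => R ≤ S),
    IncidenceAlgebra.mu ℤ R S • toPerm k S.1

/-- The stabilizer `Σ_R` of the order `R` in the symmetric group. -/
abbrev stab (R : OrderOn X) : Subgroup (Equiv.Perm X) := MulAction.stabilizer (Equiv.Perm X) R

open Classical in
/-- `e_R = ∑ Δ_σ f_R Δ_{σ⁻¹}`, where `σ` runs over representatives of `Σ / Σ_R`. -/
noncomputable def e (R : OrderOn X) : PermAlg k X :=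
  ∑ q : Equiv.Perm X ⧸ stab R,
    toPerm k (BinRel.perm q.out) * f k R * toPerm k (BinRel.perm q.out⁻¹)

/-- `P e_R = {a * e_R | a ∈ P}`, with the addition, multiplication and scalar multiplication
of `P`. (That `e_R` is its identity element is a claim, not part of the definition.) -/
noncomputable def block (R : OrderOn X) : NonUnitalSubalgebra k (PermAlg k X) where
  carrier := {x | ∃ a, x = a * e k R}
  zero_mem' := ⟨0, (zero_mul _).symm⟩
  add_mem' := by
    rintro _ _ ⟨a, rfl⟩ ⟨b, rfl⟩
    exact ⟨a + b, (add_mul _ _ _).symm⟩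
  mul_mem' := by
    rintro _ _ ⟨a, rfl⟩ ⟨b, rfl⟩
    exact ⟨a * e k R * b, (mul_assoc _ _ _).symm⟩
  smul_mem' := by
    rintro c _ ⟨a, rfl⟩
    exact ⟨c • a, (smul_mul_assoc _ _ _).symm⟩

theorem e_mem_block (R : OrderOn X) : e k R ∈ block k R := ⟨1, (one_mul _).symm⟩

/-- The matrix algebra of size `|Σ : Σ_R|` over the group algebra `k Σ_R`. -/
abbrev MatAlg (R : OrderOn X) : Type (max u v) :=
  Matrix (Fin (stab R).index) (Fin (stab R).index) (MonoidAlgebra k (stab R))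

end Orders

end PermutedOrders

namespace PermutedOrders

universe u v

namespace BinRel

variable {X : Type u}

/-- `R.Fits τ Q` says that `Δ_τ ⊆ Q ⊆ Δ_τ R`. -/
def Fits (R : BinRel X) (τ : Equiv.Perm X) (Q : BinRel X) : Prop :=
  perm τ ≤ Q ∧ Q ≤ perm τ * R

theorem fits_iff {R Q : BinRel X} {τ : Equiv.Perm X} :
    R.Fits τ Q ↔ (∀ a, Q (τ a) a) ∧ ∀ a b, Q (τ a) b → R a b := by
  constructor
  · rintro ⟨h, h'⟩
    refine ⟨fun a => h _ _ rfl, fun a b hab => ?_⟩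
    have := h' _ _ hab
    rw [perm_mul_apply] at this
    simpa using this
  · rintro ⟨h, h'⟩
    refine ⟨fun a b hab => ?_, fun a b hab => ?_⟩
    · rw [perm_apply] at hab
      exact hab ▸ h b
    · rw [perm_mul_apply]
      exact h' _ _ (by simpa using hab)

/-- A permutation of a finite set contained in a partial order is the identity. -/
theorem IsOrder.perm_eq_one [Finite X] {R : BinRel X} (hR : R.IsOrder) {σ : Equiv.Perm X}
    (h : ∀ a, R (σ a) a) : σ = 1 := by
  have hpow : ∀ n a, R ((σ ^ n) a) a := by
    intro n
    induction n with
    | zero => exact fun a => hR.refl _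
    | succ n ih =>
      intro a
      rw [pow_succ]
      exact hR.trans _ _ _ (ih (σ a)) (h a)
  obtain ⟨n, hn, hσ⟩ := isOfFinOrder_iff_pow_eq_one.1 (isOfFinOrder_of_finite σ)
  ext a
  have h1 := hpow (n - 1) (σ a)
  have h2 : (σ ^ (n - 1)) (σ a) = (σ ^ (n - 1 + 1)) a := by rw [pow_succ]; rfl
  rw [h2, Nat.sub_add_cancel hn, hσ] at h1
  exact hR.antisymm _ _ (h a) h1

theorem Fits.unique [Finite X] {R Q : BinRel X} (hR : R.IsOrder) {σ τ : Equiv.Perm X}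
    (hσ : R.Fits σ Q) (hτ : R.Fits τ Q) : σ = τ := by
  rw [fits_iff] at hσ hτ
  have : σ⁻¹ * τ = 1 := by
    apply hR.perm_eq_one
    intro a
    apply hσ.2
    simpa using hτ.1 a
  exact inv_mul_eq_one.1 this

theorem Fits.essential [Fintype X] {R Q : BinRel X} (hR : R.IsOrder) {τ : Equiv.Perm X}
    (h : R.Fits τ Q) : Q.Essential := by
  intro hQ
  rw [fits_iff] at h
  refine essential_of_le_isOrder (Q := perm τ⁻¹ * Q) (fun a => ?_) hR ?_ (hQ.mul_left _)
  · rw [perm_mul_apply]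
    simpa using h.1 a
  · intro a b hab
    rw [perm_mul_apply] at hab
    exact h.2 _ _ (by simpa using hab)

theorem fits_perm {R : BinRel X} (hR : R.IsOrder) (τ : Equiv.Perm X) : R.Fits τ (perm τ) := by
  rw [fits_iff]
  refine ⟨fun a => rfl, fun a b hab => ?_⟩
  rw [perm_apply, τ.injective.eq_iff] at hab
  exact hab ▸ hR.refl _

theorem fits_one_iff {R Q : BinRel X} (hQ : Q.IsRefl) : R.Fits 1 Q ↔ Q ≤ R := by
  rw [fits_iff]
  exact ⟨fun h => h.2, fun h => ⟨hQ, h⟩⟩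

theorem Fits.eq_one [Finite X] {R Q : BinRel X} (hR : R.IsOrder) (hQ : Q.IsRefl)
    {τ : Equiv.Perm X} (h : R.Fits τ Q) : τ = 1 := by
  rw [fits_iff] at h
  have : τ⁻¹ = 1 := by
    apply hR.perm_eq_one
    intro a
    apply h.2
    simpa using hQ a
  exact inv_eq_one.1 this

theorem tc_le_iff {R Q : BinRel X} (hR : R.IsOrder) : Q.tc ≤ R ↔ Q ≤ R := by
  refine ⟨fun h => (le_tc Q).trans h, fun h a b hab => ?_⟩
  induction hab with
  | single h' => exact h _ _ h'
  | tail _ h' ih => exact hR.trans _ _ _ ih (h _ _ h')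

end BinRel

open BinRel

theorem smul_apply {X : Type u} {σ : Equiv.Perm X} {R : OrderOn X} {a b : X} :
    (σ • R).1 a b ↔ R.1 (σ⁻¹ a) (σ⁻¹ b) := by
  rw [coe_smul, mul_perm_apply, perm_mul_apply]

theorem fits_mul {X : Type u} {R : OrderOn X} {σ τ : Equiv.Perm X} {P Q : BinRel X}
    (hQ : R.1.Fits τ Q) (hP : (τ • R).1.Fits σ P) : R.1.Fits (σ * τ) (P * Q) := by
  rw [fits_iff] at *
  refine ⟨fun a => ⟨τ a, hP.1 _, hQ.1 _⟩, ?_⟩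
  rintro a b ⟨c, hac, hcb⟩
  have h1 := hP.2 _ _ hac
  rw [smul_apply] at h1
  refine R.2.trans _ _ _ (by simpa using h1) (hQ.2 (τ⁻¹ c) b (by simpa using hcb))

theorem exists_fits_of_fits_mul {X : Type u} [Fintype X] {R : OrderOn X} {ρ : Equiv.Perm X}
    {P Q : BinRel X} (h : R.1.Fits ρ (P * Q)) :
    ∃ σ τ, R.1.Fits τ Q ∧ (τ • R).1.Fits σ P ∧ σ * τ = ρ := by
  have hes := h.essential R.2
  obtain ⟨σ, hσ⟩ := Essential.exists_perm_le (R := P) fun hP => hes (hP.mul_right _)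
  obtain ⟨τ, hτ⟩ := Essential.exists_perm_le (R := Q) fun hQ => hes (hQ.mul_left _)
  replace hσ : ∀ b, P (σ b) b := fun b => hσ _ _ rfl
  replace hτ : ∀ b, Q (τ b) b := fun b => hτ _ _ rfl
  rw [fits_iff] at h
  have e : ρ⁻¹ * (σ * τ) = 1 := by
    apply R.2.perm_eq_one
    intro a
    apply h.2
    simpa using ⟨τ a, hσ _, hτ a⟩
  obtain rfl : ρ = σ * τ := inv_mul_eq_one.1 e
  refine ⟨σ, τ, fits_iff.2 ⟨hτ, fun a b hab => h.2 _ _ ⟨τ a, hσ _, hab⟩⟩,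
    fits_iff.2 ⟨hσ, fun a b hab => ?_⟩, rfl⟩
  rw [smul_apply]
  exact h.2 _ _ ⟨b, by simpa using hab, by simpa using hτ (τ⁻¹ b)⟩

section Representation

open scoped Classical

variable (k : Type v) [CommRing k] {X : Type u}

/-- Matrices indexed by the cosets of the stabilizer of `R`, with entries in its group algebra. -/
abbrev CosetMat (R : OrderOn X) : Type (max u v) :=
  Matrix (Equiv.Perm X ⧸ stab R) (Equiv.Perm X ⧸ stab R) (MonoidAlgebra k (stab R))

variable {R : OrderOn X}

theorem out_inv_mul_mem_iff {p q : Equiv.Perm X ⧸ stab R} {τ : Equiv.Perm X} :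
    p.out⁻¹ * (τ * q.out) ∈ stab R ↔ (QuotientGroup.mk (τ * q.out) : Equiv.Perm X ⧸ stab R) = p := by
  rw [← QuotientGroup.eq, QuotientGroup.out_eq', eq_comm]

theorem out_smul_eq_iff {p q : Equiv.Perm X ⧸ stab R} : p.out • R = q.out • R ↔ p = q := by
  constructor
  · intro h
    rw [← QuotientGroup.out_eq' p, ← QuotientGroup.out_eq' q, QuotientGroup.eq,
      MulAction.mem_stabilizer_iff, mul_smul, ← h, inv_smul_smul]
  · rintro rfl
    rfl

theorem mk_out_smul (σ : Equiv.Perm X) :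
    (QuotientGroup.mk σ : Equiv.Perm X ⧸ stab R).out • R = σ • R := by
  have h : (QuotientGroup.mk σ : Equiv.Perm X ⧸ stab R) =
      QuotientGroup.mk (QuotientGroup.mk σ : Equiv.Perm X ⧸ stab R).out :=
    (QuotientGroup.out_eq' _).symm
  rw [QuotientGroup.eq, MulAction.mem_stabilizer_iff, mul_smul] at h
  exact (inv_smul_eq_iff.1 h)

variable (R)

/-- The entries of the monomial matrix by which `τ` acts on the free right module `k Σ` over the
group algebra of the stabilizer of `R`. -/
noncomputable def monomialEntry (τ : Equiv.Perm X) (p q : Equiv.Perm X ⧸ stab R) :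
    MonoidAlgebra k (stab R) :=
  if h : p.out⁻¹ * (τ * q.out) ∈ stab R then MonoidAlgebra.of k (stab R) ⟨_, h⟩ else 0

variable {R}

theorem monomialEntry_eq_zero {τ : Equiv.Perm X} {p q : Equiv.Perm X ⧸ stab R}
    (h : (QuotientGroup.mk (τ * q.out) : Equiv.Perm X ⧸ stab R) ≠ p) :
    monomialEntry k R τ p q = 0 :=
  dif_neg (mt out_inv_mul_mem_iff.1 h)

theorem monomialEntry_mul {σ τ : Equiv.Perm X} {p q r : Equiv.Perm X ⧸ stab R}
    (h : (QuotientGroup.mk (τ * r.out) : Equiv.Perm X ⧸ stab R) = q) :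
    monomialEntry k R σ p q * monomialEntry k R τ q r = monomialEntry k R (σ * τ) p r := by
  have hq := out_inv_mul_mem_iff.2 h
  have e : p.out⁻¹ * (σ * τ * r.out) = p.out⁻¹ * (σ * q.out) * (q.out⁻¹ * (τ * r.out)) := by group
  rw [monomialEntry, monomialEntry, dif_pos hq, monomialEntry]
  by_cases hp : p.out⁻¹ * (σ * q.out) ∈ stab R
  · have hpr : p.out⁻¹ * (σ * τ * r.out) ∈ stab R := e ▸ mul_mem hp hq
    rw [dif_pos hp, dif_pos hpr, ← map_mul]
    congr 1
    exact Subtype.ext e.symm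
  · have hpr : p.out⁻¹ * (σ * τ * r.out) ∉ stab R := by
      rw [e]
      exact fun h' => hp ((Subgroup.mul_mem_cancel_right _ hq).1 h')
    rw [dif_neg hp, dif_neg hpr, zero_mul]

theorem monomialEntry_one (p q : Equiv.Perm X ⧸ stab R) :
    monomialEntry k R 1 p q = (1 : CosetMat k R) p q := by
  rw [Matrix.one_apply]
  split_ifs with h
  · subst h
    have h' : p.out⁻¹ * (1 * p.out) ∈ stab R := by simp
    rw [monomialEntry, dif_pos h', ← map_one (MonoidAlgebra.of k (stab R))]
    congr 1
    exact Subtype.ext (by simp)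
  · apply monomialEntry_eq_zero
    rw [one_mul, QuotientGroup.out_eq']
    exact fun h' => h h'.symm

variable [Fintype X] (R)

/-- The entries of the matrix by which a relation acts. -/
noncomputable def relEntry (Q : BinRel X) (p q : Equiv.Perm X ⧸ stab R) :
    MonoidAlgebra k (stab R) :=
  if h : ∃ τ, (q.out • R).1.Fits τ Q then monomialEntry k R h.choose p q else 0

variable {R}

theorem relEntry_of_fits {Q : BinRel X} {p q : Equiv.Perm X ⧸ stab R} {τ : Equiv.Perm X}
    (h : (q.out • R).1.Fits τ Q) : relEntry k R Q p q = monomialEntry k R τ p q := by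
  have h' : ∃ τ, (q.out • R).1.Fits τ Q := ⟨τ, h⟩
  rw [relEntry, dif_pos h', h'.choose_spec.unique (q.out • R).2 h]

theorem relEntry_of_not_fits {Q : BinRel X} {p q : Equiv.Perm X ⧸ stab R}
    (h : ∀ τ, ¬ (q.out • R).1.Fits τ Q) : relEntry k R Q p q = 0 :=
  dif_neg (not_exists.2 h)

theorem relEntry_of_isRefl {Q : BinRel X} (hQ : Q.IsRefl) (p q : Equiv.Perm X ⧸ stab R) :
    relEntry k R Q p q = if Q ≤ (q.out • R).1 then monomialEntry k R 1 p q else 0 := by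
  split_ifs with h
  · exact relEntry_of_fits k ((fits_one_iff hQ).2 h)
  · refine relEntry_of_not_fits k fun τ hτ => h ?_
    obtain rfl := hτ.eq_one (q.out • R).2 hQ
    exact (fits_one_iff hQ).1 hτ

theorem relEntry_mul (P Q : BinRel X) (p r : Equiv.Perm X ⧸ stab R) :
    relEntry k R (P * Q) p r = ∑ q, relEntry k R P p q * relEntry k R Q q r := by
  by_cases hQ : ∃ τ, (r.out • R).1.Fits τ Q
  · obtain ⟨τ, hτ⟩ := hQ
    set q : Equiv.Perm X ⧸ stab R := QuotientGroup.mk (τ * r.out) with hq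
    have hqR : q.out • R = τ • r.out • R := by rw [hq, mk_out_smul, mul_smul]
    rw [Finset.sum_eq_single q]
    · rw [relEntry_of_fits k hτ]
      by_cases hP : ∃ σ, (q.out • R).1.Fits σ P
      · obtain ⟨σ, hσ⟩ := hP
        rw [relEntry_of_fits k hσ, monomialEntry_mul k hq.symm]
        exact relEntry_of_fits k (fits_mul hτ (hqR ▸ hσ))
      · rw [relEntry_of_not_fits k (not_exists.1 hP), zero_mul]
        refine relEntry_of_not_fits k fun ρ hρ => hP ?_
        obtain ⟨σ, τ', h1, h2, -⟩ := exists_fits_of_fits_mul hρ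
        obtain rfl := h1.unique (r.out • R).2 hτ
        exact ⟨σ, hqR ▸ h2⟩
    · intro q' _ hne
      rw [relEntry_of_fits k hτ, monomialEntry_eq_zero k (hq ▸ hne.symm), mul_zero]
    · simp
  · rw [relEntry_of_not_fits, Finset.sum_eq_zero]
    · intro q _
      rw [relEntry_of_not_fits k (not_exists.1 hQ), mul_zero]
    · intro ρ hρ
      obtain ⟨σ, τ, h, -⟩ := exists_fits_of_fits_mul hρ
      exact hQ ⟨τ, h⟩

variable (R)

/-- The matrix representation of the monoid of relations attached to the order `R`. -/
noncomputable def relRep : BinRel X →* CosetMat k R where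
  toFun Q := Matrix.of (relEntry k R Q)
  map_one' := by
    ext1 p q
    rw [Matrix.of_apply, relEntry_of_isRefl k (Q := (1 : BinRel X)) (fun _ => rfl), if_pos,
      monomialEntry_one]
    rintro a b rfl
    exact (q.out • R).2.refl _
  map_mul' P Q := by
    ext1 p q
    rw [Matrix.mul_apply]
    exact relEntry_mul k P Q p q

theorem relRep_apply (Q : BinRel X) (p q : Equiv.Perm X ⧸ stab R) :
    relRep k R Q p q = relEntry k R Q p q := rfl

theorem relRep_inessential {Q : BinRel X} (hQ : Q.Inessential) : relRep k R Q = 0 := by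
  ext1 p q
  rw [relRep_apply, Matrix.zero_apply]
  exact relEntry_of_not_fits k fun τ hτ => hτ.essential (q.out • R).2 hQ

theorem relRep_tc {Q : BinRel X} (hQ : Q.IsRefl) : relRep k R Q.tc = relRep k R Q := by
  ext1 p q
  rw [relRep_apply, relRep_apply, relEntry_of_isRefl k hQ, relEntry_of_isRefl k (tc_refl hQ)]
  simp only [tc_le_iff (q.out • R).2]

/-- The representation of the essential algebra attached to the order `R`. -/
noncomputable def essRep : EssAlg k X →ₐ[k] CosetMat k R :=
  Ideal.Quotient.liftₐ _ (MonoidAlgebra.lift k _ _ (relRep k R)) (by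
    intro a ha
    rw [mem_inessentialIdeal] at ha
    induction ha using Submodule.span_induction with
    | zero => exact map_zero _
    | add x y _ _ hx hy => rw [map_add, hx, hy, add_zero]
    | smul c x _ hx => rw [map_smul, hx, smul_zero]
    | mem x hx =>
      obtain ⟨Q, hQ, rfl⟩ := hx
      rw [MonoidAlgebra.lift_of, relRep_inessential k R hQ])

theorem essRep_toEss (Q : BinRel X) : essRep k R (toEss k Q) = relRep k R Q :=
  MonoidAlgebra.lift_of _ _

/-- The representation of the algebra of permuted orders attached to the order `R`. -/
noncomputable def permRep : PermAlg k X →ₐ[k] CosetMat k R :=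
  Ideal.Quotient.liftₐ _ (essRep k R) (by
    intro a ha
    rw [mem_nilIdeal] at ha
    induction ha using Submodule.span_induction with
    | zero => exact map_zero _
    | add x y _ _ hx hy => rw [map_add, hx, hy, add_zero]
    | smul c x _ hx => rw [map_smul, hx, smul_zero]
    | mem x hx =>
      obtain ⟨Q, σ, -, hQ, rfl⟩ := hx
      rw [map_mul, map_sub, essRep_toEss, essRep_toEss, relRep_tc k R hQ, sub_self, zero_mul])

theorem permRep_toPerm (Q : BinRel X) : permRep k R (toPerm k Q) = relRep k R Q :=
  essRep_toEss k R Q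

theorem permRep_perm_apply (τ : Equiv.Perm X) (p q : Equiv.Perm X ⧸ stab R) :
    permRep k R (toPerm k (perm τ)) p q = monomialEntry k R τ p q := by
  rw [permRep_toPerm, relRep_apply, relEntry_of_fits k (fits_perm (q.out • R).2 τ)]

theorem permRep_f (S : OrderOn X) :
    permRep k R (f k S) = Matrix.diagonal fun q => if S = q.out • R then 1 else 0 := by
  ext1 p q
  have key : ∀ S' : OrderOn X, permRep k R (toPerm k S'.1) p q =
      if S' ≤ q.out • R then (1 : CosetMat k R) p q else 0 := by
    intro S'
    rw [permRep_toPerm, relRep_apply, relEntry_of_isRefl k S'.2.refl, monomialEntry_one]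
    rfl
  have hsum : (∑ S' ∈ Finset.univ.filter (fun S' : OrderOn X => S ≤ S'),
      if S' ≤ q.out • R then IncidenceAlgebra.mu ℤ S S' else 0) =
      if S = q.out • R then 1 else 0 := by
    rw [← Finset.sum_filter, ← IncidenceAlgebra.sum_Icc_mu_right (𝕜 := ℤ) S (q.out • R)]
    refine Finset.sum_congr ?_ fun _ _ => rfl
    ext S'
    simp
  rw [f, map_sum, Matrix.sum_apply]
  simp_rw [map_zsmul, Matrix.smul_apply, key]
  trans (∑ S' ∈ Finset.univ.filter (fun S' : OrderOn X => S ≤ S'),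
      if S' ≤ q.out • R then IncidenceAlgebra.mu ℤ S S' else 0) • (1 : CosetMat k R) p q
  · rw [Finset.sum_smul]
    refine Finset.sum_congr rfl fun S' _ => ?_
    split_ifs <;> simp
  · rw [hsum, Matrix.diagonal_apply, Matrix.one_apply]
    by_cases h : p = q
    · subst h
      split_ifs <;> simp
    · simp [h]

end Representation

section Decomposition

open scoped Classical

theorem smul_mem_orbit_iff {G α : Type*} [Group G] [MulAction G α] {g : G} {a b : α} :
    g • a ∈ MulAction.orbit G b ↔ a ∈ MulAction.orbit G b := by
  rw [MulAction.mem_orbit_symm, MulAction.orbit_smul, MulAction.mem_orbit_symm]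

theorem exists_orbit_representatives (G α : Type*) [Group G] [MulAction G α] :
    ∃ T : Set α, ∀ a : α, ∃! b, b ∈ T ∧ b ∈ MulAction.orbit G a := by
  let π : α → MulAction.orbitRel.Quotient G α := Quotient.mk _
  have hπ : ∀ a b, b ∈ MulAction.orbit G a ↔ π b = π a := fun a b =>
    (MulAction.orbitRel.Quotient.mem_orbit (x := π a)).trans Iff.rfl
  refine ⟨Set.range fun c : MulAction.orbitRel.Quotient G α => c.out,
    fun a => ⟨(π a).out, ⟨⟨_, rfl⟩, (hπ _ _).2 (Quotient.out_eq _)⟩, ?_⟩⟩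
  rintro _ ⟨⟨c, rfl⟩, h⟩
  rw [hπ] at h
  have h' : c = π a := (Quotient.out_eq c).symm.trans h
  rw [h']

variable (k : Type v) [CommRing k] {X : Type u} [Fintype X]

/-- The basis elements `Δ_τ f_S` of the algebra of permuted orders. -/
noncomputable def permF (τ : Equiv.Perm X) (S : OrderOn X) : PermAlg k X :=
  toPerm k (perm τ) * f k S

variable (R : OrderOn X)

theorem permRep_permF_apply (τ : Equiv.Perm X) (S : OrderOn X) (p q : Equiv.Perm X ⧸ stab R) :
    permRep k R (permF k τ S) p q =
      if S = q.out • R then monomialEntry k R τ p q else 0 := by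
  rw [permF, map_mul, permRep_f, Matrix.mul_diagonal, permRep_perm_apply, mul_ite, mul_one,
    mul_zero]

theorem permRep_permF_eq_zero (τ : Equiv.Perm X) {S : OrderOn X}
    (h : S ∉ MulAction.orbit (Equiv.Perm X) R) : permRep k R (permF k τ S) = 0 := by
  ext1 p q
  rw [permRep_permF_apply, if_neg, Matrix.zero_apply]
  rintro rfl
  exact h (MulAction.mem_orbit _ _)

variable {R}

theorem permRep_permF_out (p q : Equiv.Perm X ⧸ stab R) (s : stab R) :
    permRep k R (permF k (p.out * s.1 * q.out⁻¹) (q.out • R)) =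
      Matrix.single p q (MonoidAlgebra.of k (stab R) s) := by
  ext1 a b
  rw [permRep_permF_apply, Matrix.single_apply]
  simp only [out_smul_eq_iff]
  by_cases hb : q = b
  · subst hb
    have e : p.out * s.1 * q.out⁻¹ * q.out = p.out * s.1 := by group
    by_cases ha : p = a
    · subst ha
      have e' : p.out⁻¹ * (p.out * s.1 * q.out⁻¹ * q.out) = s.1 := by group
      have h : p.out⁻¹ * (p.out * s.1 * q.out⁻¹ * q.out) ∈ stab R := by
        rw [e']
        exact s.2
      rw [if_pos rfl, if_pos ⟨rfl, rfl⟩, monomialEntry, dif_pos h]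
      congr 1
      exact Subtype.ext e'
    · rw [if_pos rfl, if_neg fun h => ha h.1]
      apply monomialEntry_eq_zero
      rwa [e, QuotientGroup.mk_mul_of_mem _ s.2, QuotientGroup.out_eq']
  · rw [if_neg hb, if_neg fun h => hb h.2]

variable (R)

/-- The linear map sending the matrix units to the basis elements of the block of `R`. -/
noncomputable def ofMat : CosetMat k R →ₗ[k] PermAlg k X where
  toFun M := ∑ p, ∑ q, ∑ s : stab R,
    (M p q).coeff s • permF k (p.out * s.1 * q.out⁻¹) (q.out • R)
  map_add' M N := by
    simp only [Matrix.add_apply, MonoidAlgebra.coeff_add, Finsupp.add_apply, add_smul,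
      Finset.sum_add_distrib]
  map_smul' c M := by
    simp only [Matrix.smul_apply, MonoidAlgebra.coeff_smul, Finsupp.smul_apply, smul_assoc,
      Finset.smul_sum, RingHom.id_apply]

theorem ofMat_apply (M : CosetMat k R) : ofMat k R M = ∑ p, ∑ q, ∑ s : stab R,
    (M p q).coeff s • permF k (p.out * s.1 * q.out⁻¹) (q.out • R) := rfl

variable {R}

theorem ofMat_single (p q : Equiv.Perm X ⧸ stab R) (s : stab R) :
    ofMat k R (Matrix.single p q (MonoidAlgebra.of k (stab R) s)) =
      permF k (p.out * s.1 * q.out⁻¹) (q.out • R) := by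
  rw [ofMat_apply, Finset.sum_eq_single p, Finset.sum_eq_single q, Finset.sum_eq_single s]
  · simp
  · intro t _ h
    simp [h.symm]
  · simp
  · intro b _ h
    simp [h.symm]
  · simp
  · intro b _ h
    simp [h.symm]
  · simp

theorem permRep_ofMat (M : CosetMat k R) : permRep k R (ofMat k R M) = M := by
  rw [ofMat_apply]
  simp only [map_sum, map_smul, permRep_permF_out]
  conv_rhs => rw [Matrix.matrix_eq_sum_single M]
  refine Finset.sum_congr rfl fun p _ => Finset.sum_congr rfl fun q _ => ?_
  ext a b t
  simp only [Matrix.sum_apply, Matrix.smul_apply, Matrix.single_apply, MonoidAlgebra.coeff_sum,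
    MonoidAlgebra.coeff_smul, Finsupp.finsetSum_apply, Finsupp.smul_apply]
  split_ifs with h
  · simp [Finsupp.single_apply]
  · simp

theorem permRep_ofMat_eq_zero {R' : OrderOn X} (h : R ∉ MulAction.orbit (Equiv.Perm X) R')
    (M : CosetMat k R) : permRep k R' (ofMat k R M) = 0 := by
  rw [ofMat_apply]
  simp only [map_sum, map_smul]
  refine Finset.sum_eq_zero fun p _ => Finset.sum_eq_zero fun q _ =>
    Finset.sum_eq_zero fun s _ => ?_
  rw [permRep_permF_eq_zero, smul_zero]
  rwa [smul_mem_orbit_iff]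

variable (R) in
theorem ofMat_permRep_permF (τ : Equiv.Perm X) (S : OrderOn X) :
    ofMat k R (permRep k R (permF k τ S)) =
      if S ∈ MulAction.orbit (Equiv.Perm X) R then permF k τ S else 0 := by
  split_ifs with h
  · obtain ⟨σ, rfl⟩ := h
    set q : Equiv.Perm X ⧸ stab R := QuotientGroup.mk σ with hq
    have hqR : σ • R = q.out • R := (mk_out_smul σ).symm
    set p : Equiv.Perm X ⧸ stab R := QuotientGroup.mk (τ * q.out) with hp
    have hs : p.out⁻¹ * (τ * q.out) ∈ stab R := out_inv_mul_mem_iff.2 hp.symm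
    have e : τ = p.out * (⟨_, hs⟩ : stab R).1 * q.out⁻¹ := by
      simp only
      group
    change ofMat k R (permRep k R (permF k τ (σ • R))) = permF k τ (σ • R)
    rw [hqR]
    generalize (⟨_, hs⟩ : stab R) = s at e
    rw [e, permRep_permF_out, ofMat_single]
  · rw [permRep_permF_eq_zero k R τ h, map_zero]

theorem toPerm_order_eq_sum (S : OrderOn X) :
    toPerm k S.1 = ∑ S' ∈ Finset.univ.filter (fun S' : OrderOn X => S ≤ S'), f k S' := by
  simp only [f]
  rw [Finset.sum_comm' (s' := fun U => Finset.Icc S U)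
    (t' := Finset.univ.filter (fun U : OrderOn X => S ≤ U))]
  · rw [Finset.sum_eq_single S]
    · simp
    · intro U _ hne
      rw [← Finset.sum_smul, IncidenceAlgebra.sum_Icc_mu_left, if_neg hne.symm, zero_smul]
    · simp
  · intro U V
    simp only [Finset.mem_filter, Finset.mem_univ, true_and, Finset.mem_Icc]
    exact ⟨fun h => ⟨h, h.1.trans h.2⟩, fun h => h.1⟩

theorem toPerm_tc {Q : BinRel X} (hQ : Q.IsRefl) : toPerm k Q.tc = toPerm k Q := by
  have h := sub_tc_mem k hQ 1
  rw [map_one, map_one, mul_one, ← mem_nilIdeal] at h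
  exact (Ideal.Quotient.eq.2 h).symm

theorem toPerm_eq_zero {Q : BinRel X} (h : Q.Inessential) : toPerm k Q = 0 :=
  (congrArg (Ideal.Quotient.mk (nilIdeal k X)) (toEss_eq_zero k h)).trans (map_zero _)

theorem toPerm_mem_span (Q : BinRel X) :
    toPerm k Q ∈ Submodule.span k (Set.range fun x : Equiv.Perm X × OrderOn X =>
      permF k x.1 x.2) := by
  by_cases hQ : Q.Inessential
  · rw [toPerm_eq_zero k hQ]
    exact zero_mem _
  obtain ⟨τ, hτ⟩ := Essential.exists_perm_le hQ
  have hr : (perm τ⁻¹ * Q).IsRefl := fun a => by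
    rw [perm_mul_apply]
    exact hτ _ _ (by simp [perm_apply])
  have e : toPerm k Q = toPerm k (perm τ) * toPerm k (perm τ⁻¹ * Q).tc := by
    rw [toPerm_tc k hr, ← map_mul, ← mul_assoc, ← map_mul, mul_inv_cancel, map_one, one_mul]
  rw [e]
  by_cases ho : (perm τ⁻¹ * Q).tc.IsOrder
  · rw [toPerm_order_eq_sum k ⟨_, ho⟩, Finset.mul_sum]
    exact sum_mem fun S _ => Submodule.subset_span ⟨(τ, S), rfl⟩
  · rw [toPerm_eq_zero k (inessential_of_not_isOrder (tc_refl hr)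
      (fun _ _ _ => Relation.TransGen.trans) ho), mul_zero]
    exact zero_mem _

theorem span_permF : Submodule.span k (Set.range fun x : Equiv.Perm X × OrderOn X =>
    permF k x.1 x.2) = ⊤ := by
  rw [eq_top_iff]
  rintro x -
  obtain ⟨y, rfl⟩ := Ideal.Quotient.mk_surjective x
  induction y using essAlg_induction with
  | hrel Q => exact toPerm_mem_span k Q
  | hadd a b ha hb => rw [map_add]; exact add_mem ha hb
  | hsmul r a ha => exact Submodule.smul_mem _ r ha

theorem linearMap_ext_permF {M : Type*} [AddCommMonoid M] [Module k M]
    {φ ψ : PermAlg k X →ₗ[k] M} (h : ∀ τ S, φ (permF k τ S) = ψ (permF k τ S)) : φ = ψ :=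
  LinearMap.ext_on (span_permF k) (by rintro _ ⟨x, rfl⟩; exact h x.1 x.2)

/-- The components of an element of the algebra of permuted orders, for representatives of the
orbits on the set of orders, add up to the element. -/
theorem sum_ofMat_permRep {T : Set (OrderOn X)}
    (hT : ∀ R : OrderOn X, ∃! S, S ∈ T ∧ S ∈ MulAction.orbit (Equiv.Perm X) R)
    (x : PermAlg k X) : ∑ R : T, ofMat k R.1 (permRep k R.1 x) = x := by
  have : ∑ R : T, ofMat k R.1 ∘ₗ (permRep k R.1).toLinearMap = LinearMap.id := by
    refine linearMap_ext_permF k fun τ S => ?_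
    simp only [LinearMap.sum_apply, LinearMap.comp_apply, AlgHom.toLinearMap_apply,
      ofMat_permRep_permF, LinearMap.id_apply]
    obtain ⟨U, ⟨hU, hUS⟩, huniq⟩ := hT S
    rw [Finset.sum_eq_single ⟨U, hU⟩, if_pos (MulAction.mem_orbit_symm.1 hUS)]
    · intro V _ hV
      rw [if_neg]
      intro h
      exact hV (Subtype.ext (huniq V.1 ⟨V.2, MulAction.mem_orbit_symm.1 h⟩))
    · simp
  simpa using LinearMap.congr_fun this x

theorem eq_zero_of_permRep {x : PermAlg k X} (h : ∀ R, permRep k R x = 0) : x = 0 := by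
  obtain ⟨T, hT⟩ := exists_orbit_representatives (Equiv.Perm X) (OrderOn X)
  rw [← sum_ofMat_permRep k hT x]
  exact Finset.sum_eq_zero fun R _ => by rw [h, map_zero]

theorem eq_of_permRep {x y : PermAlg k X} (h : ∀ R, permRep k R x = permRep k R y) : x = y :=
  sub_eq_zero.1 (eq_zero_of_permRep k fun R => by rw [map_sub, h, sub_self])

variable (R)

theorem permRep_conj_f (τ : Equiv.Perm X) (S : OrderOn X) :
    permRep k R (toPerm k (perm τ) * f k S * toPerm k (perm τ⁻¹)) =
      Matrix.diagonal fun q => if τ • S = q.out • R then 1 else 0 := by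
  have e : permRep k R (permF k τ S) =
      (Matrix.diagonal fun q => if τ • S = q.out • R then 1 else 0) *
        permRep k R (toPerm k (perm τ)) := by
    ext1 p q
    rw [permRep_permF_apply, Matrix.diagonal_mul, permRep_perm_apply, ite_mul, one_mul, zero_mul]
    by_cases h : (QuotientGroup.mk (τ * q.out) : Equiv.Perm X ⧸ stab R) = p
    · subst h
      simp only [mk_out_smul, mul_smul, smul_left_cancel_iff]
    · rw [monomialEntry_eq_zero k h, ite_self, ite_self]
  rw [map_mul]
  change permRep k R (permF k τ S) * _ = _
  rw [e, mul_assoc, ← map_mul, ← map_mul, ← map_mul, mul_inv_cancel, map_one, map_one, map_one,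
    mul_one]

theorem permRep_e (S : OrderOn X) :
    permRep k R (e k S) = if S ∈ MulAction.orbit (Equiv.Perm X) R then 1 else 0 := by
  rw [e, map_sum]
  simp only [permRep_conj_f]
  ext1 p q
  rw [Matrix.sum_apply]
  by_cases hpq : p = q
  · subst hpq
    simp only [Matrix.diagonal_apply_eq]
    split_ifs with h
    · rw [Matrix.one_apply_eq]
      obtain ⟨σ, hσ⟩ : p.out • R ∈ MulAction.orbit (Equiv.Perm X) S := by
        rw [smul_mem_orbit_iff]
        exact MulAction.mem_orbit_symm.1 h
      replace hσ : σ • S = p.out • R := hσ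
      rw [Finset.sum_eq_single (QuotientGroup.mk σ), mk_out_smul, if_pos hσ]
      · intro c _ hc
        rw [if_neg]
        rw [← hσ, ← mk_out_smul σ, out_smul_eq_iff]
        exact hc
      · simp
    · rw [Matrix.zero_apply]
      refine Finset.sum_eq_zero fun c _ => if_neg fun hc => h ?_
      rw [← smul_mem_orbit_iff (g := c.out), hc]
      exact MulAction.mem_orbit _ _
  · simp only [Matrix.diagonal_apply_ne _ hpq, Finset.sum_const_zero]
    split_ifs <;> simp [hpq]

theorem e_mul_comm (p : PermAlg k X) : e k R * p = p * e k R := by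
  refine eq_of_permRep k fun S => ?_
  rw [map_mul, map_mul, permRep_e]
  split_ifs <;> simp

theorem isIdempotentElem_e : IsIdempotentElem (e k R) := by
  refine eq_of_permRep k fun S => ?_
  rw [map_mul, permRep_e]
  split_ifs <;> simp

theorem permF_mul_e (τ : Equiv.Perm X) (S : OrderOn X) :
    permF k τ S * e k R = if S ∈ MulAction.orbit (Equiv.Perm X) R then permF k τ S else 0 := by
  refine eq_of_permRep k fun U => ?_
  rw [map_mul, permRep_e, apply_ite (permRep k U), map_zero]
  by_cases hS : S ∈ MulAction.orbit (Equiv.Perm X) U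
  · have h : R ∈ MulAction.orbit (Equiv.Perm X) U ↔ S ∈ MulAction.orbit (Equiv.Perm X) R := by
      rw [← MulAction.orbit_eq_iff] at hS
      rw [← hS, MulAction.mem_orbit_symm]
    simp only [h, mul_ite, mul_one, mul_zero]
  · rw [permRep_permF_eq_zero k U τ hS, zero_mul, ite_self]

theorem ofMat_permRep (x : PermAlg k X) : ofMat k R (permRep k R x) = x * e k R := by
  have : ofMat k R ∘ₗ (permRep k R).toLinearMap = LinearMap.mulRight k (e k R) := by
    refine linearMap_ext_permF k fun τ S => ?_
    rw [LinearMap.mulRight_apply, permF_mul_e]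
    exact ofMat_permRep_permF k R τ S
  exact LinearMap.congr_fun this x

theorem permRep_e_self : permRep k R (e k R) = 1 := by
  rw [permRep_e, if_pos (MulAction.mem_orbit_self _)]

/-- The block of `R` is a matrix algebra over the group algebra of the stabilizer of `R`. -/
noncomputable def blockEquiv : block k R ≃ₗ[k] CosetMat k R :=
  LinearEquiv.ofBijective
    { toFun := fun x => permRep k R x.1
      map_add' := fun x y => map_add (permRep k R) x.1 y.1
      map_smul' := fun c x => map_smul (permRep k R) c x.1 } <| by
    constructor
    · rintro ⟨_, a, rfl⟩ ⟨_, b, rfl⟩ h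
      have h' := congrArg (ofMat k R) h
      change ofMat k R (permRep k R (a * e k R)) = ofMat k R (permRep k R (b * e k R)) at h'
      rw [ofMat_permRep, ofMat_permRep, mul_assoc, mul_assoc, isIdempotentElem_e k R] at h'
      exact Subtype.ext h'
    · intro M
      refine ⟨⟨ofMat k R M * e k R, _, rfl⟩, ?_⟩
      change permRep k R (ofMat k R M * e k R) = M
      rw [map_mul, permRep_e_self, mul_one, permRep_ofMat]

/-- The matrices indexed by cosets are the matrices of size the index of the stabilizer. -/
noncomputable def cosetMatEquiv : CosetMat k R ≃ₐ[k] MatAlg k R :=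
  Matrix.reindexAlgEquiv k _ (Finite.equivFinOfCardEq rfl)

theorem pi_permRep_bijective {T : Set (OrderOn X)}
    (hT : ∀ R : OrderOn X, ∃! S, S ∈ T ∧ S ∈ MulAction.orbit (Equiv.Perm X) R) :
    Function.Bijective (AlgHom.pi fun R : T => permRep k R.1) := by
  constructor
  · intro x y h
    rw [← sum_ofMat_permRep k hT x, ← sum_ofMat_permRep k hT y]
    exact Finset.sum_congr rfl fun R _ => congrArg (ofMat k R.1) (congrFun h R)
  · intro M
    refine ⟨∑ R : T, ofMat k R.1 (M R), funext fun R => ?_⟩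
    change permRep k R.1 _ = _
    rw [map_sum, Finset.sum_eq_single R, permRep_ofMat]
    · intro S _ hS
      refine permRep_ofMat_eq_zero k (fun h => hS (Subtype.ext ?_)) _
      exact (hT R.1).unique ⟨S.2, h⟩ ⟨R.2, MulAction.mem_orbit_self _⟩
    · simp

end Decomposition

end PermutedOrders

open PermutedOrders in
theorem theorem7p5 {k : Type*} [CommRing k] {X : Type*} [Fintype X] :
    (∀ R : OrderOn X,
      IsIdempotentElem (e k R) ∧ (∀ p : PermAlg k X, e k R * p = p * e k R) ∧
      ∃ φ : block k R ≃ₗ[k] MatAlg k R,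
        φ ⟨e k R, e_mem_block k R⟩ = 1 ∧ ∀ x y : block k R, φ (x * y) = φ x * φ y) ∧
    (∀ T : Set (OrderOn X),
      (∀ R : OrderOn X, ∃! S, S ∈ T ∧ S ∈ MulAction.orbit (Equiv.Perm X) R) →
      Nonempty (PermAlg k X ≃ₐ[k] ((R : T) → MatAlg k (R : OrderOn X)))) := by
  classical
  refine ⟨fun R => ⟨isIdempotentElem_e k R, e_mul_comm k R,
    (blockEquiv k R).trans (cosetMatEquiv k R).toLinearEquiv, ?_, fun x y => ?_⟩, fun T hT => ?_⟩
  · change cosetMatEquiv k R (permRep k R (e k R)) = 1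
    rw [permRep_e_self, map_one]
  · change cosetMatEquiv k R (permRep k R (x.1 * y.1)) =
      cosetMatEquiv k R (permRep k R x.1) * cosetMatEquiv k R (permRep k R y.1)
    rw [map_mul, map_mul]
  · exact ⟨(AlgEquiv.ofBijective _ (pi_permRep_bijective k hT)).trans
      (AlgEquiv.piCongrRight fun R : T => cosetMatEquiv k R.1)⟩
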